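/- A compact ordered space is a set $X$ with a compact topology and a partial order that is closed in $X\times X$; let $\mathsf{CompOrd}$ be the category of compact ordered spaces and order-preserving continuous maps. Signatures may be large (a proper class of operation symbols) and may have symbols of infinite arity. A class of algebras of a common signature, regarded as a category with all homomorphisms as morphisms, is called a variety if it can be presented by a class of equations and has free algebras over every set. For an algebra $A$, let $\mathbf{SP}(A)$ denote the class of algebras isomorphic to a subalgebra of a power $A^I$, with $I$ a set. Let $\Sigma^{\mathrm{OC}}$ be the signature whose operation symbols of arity $\kappa$, for each cardinal $\kappa$, are the order-preserving continuous functions $[0,1]^\kappa\to[0,1]$, where $[0,1]^\kappa$ has the product topology and the coordinatewise order, and let $\Sigma^{\mathrm{OC}}_{\le\omega}$ be its sub-signature of symbols of at most countable arity; both are interpreted on $[0,1]$ in the obvious way. Then $\mathsf{CompOrd}$ is dually equivalent to a variety of algebras whose primitive operations have at most countable arity. More concretely, both $\mathbf{SP}(\langle[0,1];\Sigma^{\mathrm{OC}}\rangle)$ and $\mathbf{SP}(\langle[0,1];\Sigma^{\mathrm{OC}}_{\le\omega}\rangle)$ are varieties of algebras, and $\mathsf{CompOrd}$ is dually equivalent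 to each of them. -/

import Mathlib

open CategoryTheory

universe v u

/-- A compact ordered space: a set with a compact topology and a partial order that is closed
in `X × X` (this is `OrderClosedTopology`). -/
structure CompOrd : Type (u + 1) where
  carrier : Type u
  [top : TopologicalSpace carrier]
  [ord : PartialOrder carrier]
  [compact : CompactSpace carrier]
  [closed : OrderClosedTopology carrier]

namespace CompOrd

instance : CoeSort CompOrd.{u} (Type u) := ⟨CompOrd.carrier⟩

attribute [instance] CompOrd.top CompOrd.ord CompOrd.compact CompOrd.closed

/-- Morphisms are the order-preserving continuous maps. -/
instance : Category.{u} CompOrd.{u} where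
  Hom X Y := ContinuousOrderHom X Y
  id X := ContinuousOrderHom.id X
  comp f g := ContinuousOrderHom.comp g f

end CompOrd

/-- A (possibly large, possibly infinitary) signature: a class of operation symbols, each with a
set of argument places as its arity. -/
structure Signature : Type (max (v + 1) (u + 1)) where
  Op : Type v
  arity : Op → Type u

namespace Signature

/-- An algebra in the signature `S`. -/
structure Alg (S : Signature.{v, u}) : Type (max v (u + 1)) where
  carrier : Type u
  op : ∀ f : S.Op, (S.arity f → carrier) → carrier

instance (S : Signature.{v, u}) : CoeSort S.Alg (Type u) := ⟨Alg.carrier⟩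

namespace Alg

variable {S : Signature.{v, u}}

/-- Homomorphisms: maps that commute with every operation. -/
@[ext]
structure Hom (A B : S.Alg) : Type u where
  toFun : A → B
  map_op : ∀ (f : S.Op) (a : S.arity f → A), toFun (A.op f a) = B.op f (fun i => toFun (a i))

instance : Category.{u} S.Alg where
  Hom A B := Hom A B
  id A := ⟨fun a => a, fun _ _ => rfl⟩
  comp g h := ⟨fun a => h.toFun (g.toFun a), fun f a => by rw [g.map_op, h.map_op]⟩

/-- The direct product of a family of algebras, with coordinatewise operations. -/
def pi {I : Type u} (A : I → S.Alg) : S.Alg where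
  carrier := ∀ i, A i
  op f a := fun i => (A i).op f (fun j => a j i)

end Alg

/-- Terms over a set `X` of variables. -/
inductive Term (S : Signature.{v, u}) (X : Type u) : Type (max v u)
  | var (x : X) : Term S X
  | app (f : S.Op) (t : S.arity f → Term S X) : Term S X

/-- The value of a term in an algebra, under an assignment of the variables. -/
def Term.eval {S : Signature.{v, u}} {X : Type u} (A : S.Alg) (a : X → A) : S.Term X → A
  | .var x => a x
  | .app f t => A.op f (fun i => Term.eval A a (t i))

/-- An equation between two terms over a common set of variables. -/
structure Equation (S : Signature.{v, u}) : Type (max v (u + 1)) where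
  Var : Type u
  lhs : S.Term Var
  rhs : S.Term Var

/-- The algebra `A` satisfies the (universally quantified) equation `e`. -/
def Alg.Satisfies {S : Signature.{v, u}} (A : S.Alg) (e : S.Equation) : Prop :=
  ∀ a : e.Var → A, e.lhs.eval A a = e.rhs.eval A a

section Classes

variable {S : Signature.{v, u}}

/-- `P(K)`: the algebras isomorphic to a direct product of a family of algebras in `K`. -/
def prodClass (K : ObjectProperty S.Alg) : ObjectProperty S.Alg := fun A =>
  ∃ (I : Type u) (B : I → S.Alg), (∀ i, K (B i)) ∧ Nonempty (A ≅ Alg.pi B)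

/-- `S(K)`: the algebras that are, up to isomorphism, subalgebras of an algebra in `K`, that is,
the algebras with an injective homomorphism to some algebra in `K`. -/
def subClass (K : ObjectProperty S.Alg) : ObjectProperty S.Alg := fun A =>
  ∃ B : S.Alg, K B ∧ ∃ h : A ⟶ B, Function.Injective h.toFun

/-- `SP(A)` for a single algebra `A`. -/
def SP (A : S.Alg) : ObjectProperty S.Alg := subClass (prodClass (fun B => B = A))

/-- The class `K` can be presented by a class of equations. -/
def IsEquational (K : ObjectProperty S.Alg) : Prop :=
  ∃ E : Set S.Equation, ∀ A : S.Alg, K A ↔ ∀ e ∈ E, A.Satisfies e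

/-- The class `K` has free algebras over all sets. -/
def HasFreeAlgebras (K : ObjectProperty S.Alg) : Prop :=
  ∀ X : Type u, ∃ (F : S.Alg) (ι : X → F), K F ∧
    ∀ B : S.Alg, K B → ∀ g : X → B, ∃! h : F ⟶ B, ∀ x, h.toFun (ι x) = g x

/-- A variety of algebras: an equationally presentable class that has free algebras. -/
def IsVariety (K : ObjectProperty S.Alg) : Prop :=
  IsEquational K ∧ HasFreeAlgebras K

end Classes

/-- The signature of order-preserving continuous functions: for each cardinal `κ`, the operation
symbols of arity `κ` are the order-preserving continuous maps `[0,1]^κ → [0,1]`.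
The type `κ.out` is a chosen set of cardinality `κ`. -/
def OC : Signature.{u + 1, u} where
  Op := Σ κ : Cardinal.{u}, ContinuousOrderHom (κ.out → unitInterval) unitInterval
  arity f := f.1.out

/-- The sub-signature of `OC` of the operation symbols of at most countable arity. -/
def OCω : Signature.{u + 1, u} where
  Op := {f : OC.{u}.Op // f.1 ≤ Cardinal.aleph0}
  arity f := OC.{u}.arity f.1

/-- `[0,1]` (lifted to the universe `u`) with the obvious interpretation of the symbols of `OC`. -/
def intervalOC : OC.{u}.Alg where
  carrier := ULift.{u} unitInterval
  op f a := ULift.up (f.2 (fun i => (a i).down))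

/-- `[0,1]` (lifted to the universe `u`) with the obvious interpretation of the symbols of
`OCω`. -/
def intervalOCω : OCω.{u}.Alg where
  carrier := ULift.{u} unitInterval
  op f a := ULift.up (f.1.2 (fun i => (a i).down))

end Signature

open Set Filter Topology unitInterval

/-! ### Closed preorders on compact Hausdorff spaces -/

/-! The interval is a cogenerator of compact ordered spaces and is injective along closed subspaces:
the ordered Urysohn lemma separates points, and Nachbin's theorem (`exists_extension`) extends
monotone functions. Besides monotone continuous operations, the signature only has to satisfy
`IsComplete`: every monotone continuous function on a cube is a term. Hence the functions on
`[0,1]^X` form the free algebra on `X`, and every monotone function on a closed subspace of a cube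
is a term in the coordinates. This gives the duality. A homomorphism from the functions on `X` to
the interval is a point of a cube, and it lies in the image of `X`, because functions that agree on
the image are values of the same element; and an algebra in `SP` consists of all functions on its
spectrum.

The hard point is that the class is equational. A model of the equations of the interval is the
quotient of a free algebra by a congruence θ, and θ must be recovered from the points where its
pairs agree (`rel_of_eq_on_points`). A pair of functions on a space is a function on two copies of
it; θ puts a closed preorder on the two copies, and by extension θ contains every pair monotone for
it. Transitivity of θ makes each relation between the copies interpolate (`exists_interpolant`); a
maximal element and symmetry then give a point in between where all pairs agree.

Countable arities suffice because, by uniform continuity, a continuous function on a cube depends on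
countably many coordinates. -/

/-- A preorder relation on a topological space whose graph is closed. -/
structure IsClosedPreorder {X : Type*} [TopologicalSpace X] (r : X → X → Prop) : Prop where
  refl : ∀ x, r x x
  trans : ∀ {x y z}, r x y → r y z → r x z
  isClosed : IsClosed {p : X × X | r p.1 p.2}

theorem isClosedPreorder_le {X : Type*} [TopologicalSpace X] [Preorder X] [OrderClosedTopology X] :
    IsClosedPreorder (fun x y : X => x ≤ y) :=
  ⟨le_refl, le_trans, OrderClosedTopology.isClosed_le'⟩

/-- The preorder determined by a family of continuous functions. -/
theorem isClosedPreorder_of_family {X ι : Type*} [TopologicalSpace X] (e : ι → C(X, I)) :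
    IsClosedPreorder (fun x y : X => ∀ i, e i x ≤ e i y) where
  refl _ _ := le_rfl
  trans h h' i := (h i).trans (h' i)
  isClosed := by
    simp only [ofPred_forall]
    exact isClosed_iInter fun i => isClosed_le (by fun_prop) (by fun_prop)

namespace IsClosedPreorder

variable {X : Type*} [TopologicalSpace X] {r : X → X → Prop}

theorem swap (hr : IsClosedPreorder r) : IsClosedPreorder (fun x y => r y x) :=
  ⟨hr.refl, fun h h' => hr.trans h' h, hr.isClosed.preimage continuous_swap⟩

variable [CompactSpace X]

theorem isClosed_upper (hr : IsClosedPreorder r) {s : Set X} (hs : IsClosed s) :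
    IsClosed {y | ∃ x ∈ s, r x y} := by
  have h : {y | ∃ x ∈ s, r x y} = Prod.snd '' ({p : X × X | r p.1 p.2} ∩ Prod.fst ⁻¹' s) := by
    ext y
    simp [and_comm]
  rw [h]
  exact isClosedMap_snd_of_compactSpace _ (hr.isClosed.inter (hs.preimage continuous_fst))

theorem isClosed_lower (hr : IsClosedPreorder r) {s : Set X} (hs : IsClosed s) :
    IsClosed {x | ∃ y ∈ s, r x y} :=
  hr.swap.isClosed_upper hs

variable [T2Space X]

/-- Between a closed set and an open lower set there is an open lower set together with its
closure. -/
theorem exists_isOpen_lower (hr : IsClosedPreorder r) {c u : Set X} (hc : IsClosed c)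
    (hu : IsOpen u) (hcu : c ⊆ u) (hlow : ∀ x y, r x y → y ∈ u → x ∈ u) :
    ∃ v, IsOpen v ∧ c ⊆ v ∧ closure v ⊆ u ∧ ∀ x y, r x y → y ∈ v → x ∈ v := by
  obtain ⟨o, ho, hco, hou⟩ := normal_exists_closure_subset (hr.isClosed_lower hc) hu
    (fun x ⟨y, hy, hxy⟩ => hlow x y hxy (hcu hy))
  -- The complement of the upper closure of `oᶜ` is the largest lower set inside `o`.
  refine ⟨{y | ∃ x ∈ oᶜ, r x y}ᶜ, (hr.isClosed_upper ho.isClosed_compl).isOpen_compl, ?_, ?_, ?_⟩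
  · rintro y hy ⟨x, hx, hxy⟩
    exact hx (hco ⟨y, hy, hxy⟩)
  · refine (closure_mono ?_).trans hou
    intro y hy
    by_contra h
    exact hy ⟨y, h, hr.refl y⟩
  · rintro x y hxy hy ⟨z, hz, hzx⟩
    exact hy ⟨z, hz, hr.trans hzx hxy⟩

/-- The ordered version of Urysohn's lemma. -/
theorem exists_urysohn (hr : IsClosedPreorder r) {s t : Set X} (hs : IsClosed s)
    (ht : IsClosed t) (hst : ∀ x ∈ t, ∀ y ∈ s, ¬ r x y) :
    ∃ f : C(X, ℝ), (∀ x y, r x y → f x ≤ f y) ∧ EqOn f 0 s ∧ EqOn f 1 t ∧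
      ∀ x, f x ∈ Icc (0 : ℝ) 1 := by
  -- `P` keeps every open set of the Urysohn construction a lower set, which makes all
  -- approximations monotone.
  let P : Set X → Set X → Prop := fun _ u => ∀ x y, r x y → y ∈ u → x ∈ u
  let c : Urysohns.CU P :=
  { C := s
    U := {y | ∃ x ∈ t, r x y}ᶜ
    P_C_U := by
      rintro x y hxy hy ⟨z, hz, hzx⟩
      exact hy ⟨z, hz, hr.trans hzx hxy⟩
    closed_C := hs
    open_U := (hr.isClosed_upper ht).isOpen_compl
    subset := fun y hy ⟨x, hx, hxy⟩ => hst x hx y hy hxy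
    hP := by
      intro c u hc hP hu hcu
      obtain ⟨v, h1, h2, h3, h4⟩ := hr.exists_isOpen_lower hc hu hcu hP
      exact ⟨v, h1, h2, h3, h4, hP⟩ }
  have happrox : ∀ n (c : Urysohns.CU P) x y, r x y → c.approx n x ≤ c.approx n y := by
    intro n
    induction n with
    | zero =>
      intro c x y hxy
      by_cases hy : y ∈ c.U
      · exact (indicator_of_notMem (not_not.2 (c.P_C_U x y hxy hy)) _).trans_le
          (c.approx_nonneg 0 y)
      · exact (c.approx_le_one 0 x).trans_eq (c.approx_of_notMem_U 0 hy).symm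
    | succ n ih =>
      intro c x y hxy
      exact midpoint_le_midpoint (ih _ _ _ hxy) (ih _ _ _ hxy)
  refine ⟨⟨c.lim, c.continuous_lim⟩, fun x y hxy => ?_, c.lim_of_mem_C, fun x hx => ?_,
    c.lim_mem_Icc⟩
  · exact le_of_tendsto_of_tendsto' (c.tendsto_approx_atTop x) (c.tendsto_approx_atTop y)
      fun n => happrox n c x y hxy
  · exact c.lim_of_notMem_U _ fun h => h ⟨x, hx, hr.refl x⟩

/-- Approximate extension of monotone functions defined on a closed subset. -/
theorem exists_approx_extension (hr : IsClosedPreorder r) {A : Set X} (hA : IsClosed A)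
    {f : X → I} (hf : ContinuousOn f A) (hmono : ∀ x ∈ A, ∀ y ∈ A, r x y → f x ≤ f y)
    (n : ℕ) (hn : 0 < n) :
    ∃ g : C(X, ℝ), (∀ x y, r x y → g x ≤ g y) ∧ ∀ x ∈ A, |g x - f x| ≤ 1 / n := by
  have hn' : (0 : ℝ) < n := by exact_mod_cast hn
  have hfR : ContinuousOn (fun x => (f x : ℝ)) A := continuous_subtype_val.comp_continuousOn hf
  -- On `A`, `h k` climbs from 0 to 1 between the levels k/n and (k+1)/n of `f`; the approximation
  -- is the average of these n steps.
  have hU : ∀ k : ℕ, ∃ h : C(X, ℝ), (∀ x y, r x y → h x ≤ h y) ∧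
      EqOn h 0 (A ∩ (fun x => (f x : ℝ)) ⁻¹' Iic (k / n : ℝ)) ∧
      EqOn h 1 (A ∩ (fun x => (f x : ℝ)) ⁻¹' Ici ((k + 1) / n : ℝ)) ∧
      ∀ x, h x ∈ Icc (0 : ℝ) 1 := by
    intro k
    refine hr.exists_urysohn (hfR.preimage_isClosed_of_isClosed hA isClosed_Iic)
      (hfR.preimage_isClosed_of_isClosed hA isClosed_Ici) ?_
    rintro x ⟨hx, hfx⟩ y ⟨hy, hfy⟩ hxy
    have h1 : (f x : ℝ) ≤ f y := hmono x hx y hy hxy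
    simp only [mem_preimage, mem_Ici, mem_Iic] at hfx hfy
    have h2 : ((k + 1) / n : ℝ) ≤ k / n := hfx.trans (h1.trans hfy)
    rw [div_le_div_iff_of_pos_right hn'] at h2
    linarith
  choose h hm h0 h1 h01 using hU
  refine ⟨⟨fun x => (∑ k ∈ Finset.range n, h k x) / n, by fun_prop⟩, fun x y hxy => ?_,
    fun x hx => ?_⟩
  · exact div_le_div_of_nonneg_right (Finset.sum_le_sum fun k _ => hm k x y hxy) hn'.le
  -- Only step `j` is undetermined at `x`, so the sum of the steps and n·f(x) both lie in [j, j+1].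
  · obtain ⟨j, hj⟩ : ∃ j : ℕ, j = ⌊(n * f x : ℝ)⌋₊ := ⟨_, rfl⟩
    have hpos : (0 : ℝ) ≤ n * f x := mul_nonneg hn'.le (f x).2.1
    have hj1 : (j : ℝ) ≤ n * f x := hj ▸ Nat.floor_le hpos
    have hj2 : (n * f x : ℝ) < j + 1 := hj ▸ Nat.lt_floor_add_one _
    have hjn : j ≤ n := by
      have : (n * f x : ℝ) ≤ n := mul_le_of_le_one_right hn'.le (f x).2.2
      exact_mod_cast hj1.trans this
    have hlow : ∀ k, k < j → h k x = 1 := fun k hk => h1 k ⟨hx, by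
      simp only [mem_preimage, mem_Ici]
      rw [div_le_iff₀ hn']
      have : (k + 1 : ℝ) ≤ j := by exact_mod_cast hk
      linarith⟩
    have hhigh : ∀ k, j + 1 ≤ k → h k x = 0 := fun k hk => h0 k ⟨hx, by
      simp only [mem_preimage, mem_Iic]
      rw [le_div_iff₀ hn']
      have : (j + 1 : ℝ) ≤ k := by exact_mod_cast hk
      linarith⟩
    have hge : (j : ℝ) ≤ ∑ k ∈ Finset.range n, h k x := by
      calc (j : ℝ) = ∑ k ∈ Finset.range j, h k x := by
            rw [Finset.sum_congr rfl fun k hk => hlow k (Finset.mem_range.1 hk)]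
            simp
        _ ≤ _ := Finset.sum_le_sum_of_subset_of_nonneg (Finset.range_mono hjn)
            fun k _ _ => (h01 k x).1
    have hle : ∑ k ∈ Finset.range n, h k x ≤ j + 1 := by
      calc ∑ k ∈ Finset.range n, h k x ≤ ∑ k ∈ Finset.range n, if k < j + 1 then (1 : ℝ) else 0 := by
            refine Finset.sum_le_sum fun k _ => ?_
            split_ifs with hk
            · exact (h01 k x).2
            · exact (hhigh k (not_lt.1 hk)).le
        _ ≤ j + 1 := by
            rw [← Finset.sum_filter, Finset.sum_const, nsmul_eq_mul, mul_one]
            have : ((Finset.range n).filter (· < j + 1)).card ≤ (Finset.range (j + 1)).card :=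
              Finset.card_le_card fun k hk => Finset.mem_range.2 (Finset.mem_filter.1 hk).2
            rw [Finset.card_range] at this
            exact_mod_cast this
    have : (∑ k ∈ Finset.range n, h k x) / n - f x
        = ((∑ k ∈ Finset.range n, h k x) - n * f x) / n := by
      field_simp
    simp only [ContinuousMap.coe_mk]
    rw [this, abs_div, abs_of_pos hn', div_le_div_iff_of_pos_right hn', abs_le]
    constructor <;> linarith

/-- Nachbin's extension theorem: a continuous monotone function on a closed subset of a compact
space with a closed preorder extends to the whole space. -/
theorem exists_extension (hr : IsClosedPreorder r) {A : Set X} (hA : IsClosed A)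
    {f : X → I} (hf : ContinuousOn f A) (hmono : ∀ x ∈ A, ∀ y ∈ A, r x y → f x ≤ f y) :
    ∃ g : C(X, I), (∀ x y, r x y → g x ≤ g y) ∧ ∀ x ∈ A, g x = f x := by
  have happ : ∀ n : ℕ, ∃ g : C(X, ℝ), (∀ x y, r x y → g x ≤ g y) ∧
      ∀ x ∈ A, |g x - f x| ≤ 1 / ((2 ^ n : ℕ) : ℝ) := fun n =>
    hr.exists_approx_extension hA hf hmono (2 ^ n) (by positivity)
  choose F hFm hFA using happ
  -- Clamping `F (n + 1)` to a band around `G n` forces uniform convergence. On `A` the clamp is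
  -- idle, since 2^(-n) + 2^(-n-1) < 2·2^(-n).
  let G : ℕ → C(X, ℝ) := fun n => Nat.rec (F 0) (fun n g =>
    ⟨fun x => max (g x - 2 * (1 / 2) ^ n) (min (F (n + 1) x) (g x + 2 * (1 / 2) ^ n)),
      by fun_prop⟩) n
  have hGs : ∀ n x, G (n + 1) x =
      max (G n x - 2 * (1 / 2) ^ n) (min (F (n + 1) x) (G n x + 2 * (1 / 2) ^ n)) :=
    fun n x => rfl
  have hGm : ∀ n x y, r x y → G n x ≤ G n y := by
    intro n
    induction n with
    | zero => exact hFm 0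
    | succ n ih =>
      intro x y hxy
      rw [hGs, hGs]
      have h1 := ih x y hxy
      have h2 := hFm (n + 1) x y hxy
      gcongr
  have hFA' : ∀ n, ∀ x ∈ A, |F n x - f x| ≤ (1 / 2 : ℝ) ^ n := by
    intro n x hx
    refine (hFA n x hx).trans (le_of_eq ?_)
    push_cast
    rw [one_div_pow]
  have hGA : ∀ n, ∀ x ∈ A, G n x = F n x := by
    intro n
    induction n with
    | zero => intro x _; rfl
    | succ n ih =>
      intro x hx
      have h1 := abs_le.1 (hFA' n x hx)
      have h2 := abs_le.1 (hFA' (n + 1) x hx)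
      have h3 : (0 : ℝ) < (1 / 2) ^ n := by positivity
      rw [pow_succ] at h2
      rw [hGs, ih x hx, min_eq_left (by linarith), max_eq_right (by linarith)]
  have hdist : ∀ n, dist (G n) (G (n + 1)) ≤ 2 * (1 / 2 : ℝ) ^ n := by
    intro n
    have h3 : (0 : ℝ) < (1 / 2) ^ n := by positivity
    rw [ContinuousMap.dist_le (by positivity)]
    intro x
    rw [Real.dist_eq, hGs, abs_le]
    have h1 := le_max_left (G n x - 2 * (1 / 2) ^ n)
      (min (F (n + 1) x) (G n x + 2 * (1 / 2) ^ n))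
    have h2 : max (G n x - 2 * (1 / 2) ^ n) (min (F (n + 1) x) (G n x + 2 * (1 / 2) ^ n))
        ≤ G n x + 2 * (1 / 2) ^ n := max_le (by linarith) (min_le_right _ _)
    constructor <;> linarith
  obtain ⟨g, hg⟩ := cauchySeq_tendsto_of_complete
    (cauchySeq_of_le_geometric (1 / 2 : ℝ) 2 (by norm_num) hdist)
  have hgx : ∀ x, Tendsto (fun n => G n x) atTop (𝓝 (g x)) := fun x =>
    ((continuous_eval_const x).tendsto g).comp hg
  refine ⟨⟨fun x => projIcc 0 1 zero_le_one (g x), by fun_prop⟩, fun x y hxy => ?_,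
    fun x hx => ?_⟩
  · exact monotone_projIcc zero_le_one (le_of_tendsto_of_tendsto' (hgx x) (hgx y) fun n => hGm n x y hxy)
  · have hlim : Tendsto (fun n => G n x) atTop (𝓝 (f x : ℝ)) := by
      rw [tendsto_iff_dist_tendsto_zero]
      refine squeeze_zero (fun _ => dist_nonneg) (fun n => ?_)
        (tendsto_pow_atTop_nhds_zero_of_lt_one (r := (1 / 2 : ℝ)) (by norm_num) (by norm_num))
      rw [hGA n x hx, Real.dist_eq]
      exact hFA' n x hx
    have : g x = f x := tendsto_nhds_unique (hgx x) hlim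
    simp only [ContinuousMap.coe_mk]
    rw [this, projIcc_val]

/-- Extension of a monotone function from a closed set by a value at one more point. -/
theorem exists_extension_insert (hr : IsClosedPreorder r) {A : Set X} (hA : IsClosed A)
    {f : X → I} (hf : ContinuousOn f A) (hmono : ∀ x ∈ A, ∀ y ∈ A, r x y → f x ≤ f y)
    {p : X} (hp : p ∉ A) (c : I) (hlow : ∀ x ∈ A, r x p → f x ≤ c)
    (hhigh : ∀ x ∈ A, r p x → c ≤ f x) :
    ∃ g : C(X, I), (∀ x y, r x y → g x ≤ g y) ∧ (∀ x ∈ A, g x = f x) ∧ g p = c := by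
  classical
  have hne : ∀ x ∈ A, Function.update f p c x = f x := fun x hx =>
    Function.update_of_ne (fun h : x = p => hp (h ▸ hx)) _ _
  obtain ⟨g, hgm, hg⟩ := hr.exists_extension (A := A ∪ {p}) (f := Function.update f p c)
    (hA.union isClosed_singleton)
    ((hf.congr hne).union_of_isClosed (continuousOn_singleton _ _) hA isClosed_singleton) (by
      rintro x (hx | rfl) y (hy | rfl) hxy
      · rw [hne x hx, hne y hy]; exact hmono x hx y hy hxy
      · rw [hne x hx, Function.update_self]; exact hlow x hx hxy
      · rw [hne y hy, Function.update_self]; exact hhigh y hy hxy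
      · rfl)
  refine ⟨g, hgm, fun x hx => (hg x (Or.inl hx)).trans (hne x hx), ?_⟩
  rw [hg p (Or.inr rfl), Function.update_self]

/-- The ordered version of Urysohn's lemma, with values in the unit interval. -/
theorem exists_urysohn_unitInterval (hr : IsClosedPreorder r) {s t : Set X} (hs : IsClosed s)
    (ht : IsClosed t) (hst : ∀ x ∈ t, ∀ y ∈ s, ¬ r x y) :
    ∃ f : C(X, I), (∀ x y, r x y → f x ≤ f y) ∧ (∀ x ∈ s, f x = 0) ∧ ∀ x ∈ t, f x = 1 := by
  obtain ⟨f, hm, h0, h1, h01⟩ := hr.exists_urysohn hs ht hst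
  exact ⟨⟨fun x => ⟨f x, h01 x⟩, by fun_prop⟩, hm, fun x hx => Subtype.ext (h0 hx),
    fun x hx => Subtype.ext (h1 hx)⟩

end IsClosedPreorder

/-! ### Compact ordered spaces -/

section CompactOrdered

variable {X : Type*} [TopologicalSpace X] [PartialOrder X] [CompactSpace X] [OrderClosedTopology X]

/-- A continuous map that preserves the order is a morphism to the unit interval. -/
def ContinuousMap.toContinuousOrderHom {X : Type*} [TopologicalSpace X] [Preorder X]
    (f : C(X, I)) (hf : ∀ x y, x ≤ y → f x ≤ f y) : X →Co I where
  toFun := f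
  monotone' x y := hf x y
  continuous_toFun := f.continuous

/-- The morphisms to the unit interval determine the order. -/
theorem le_of_forall_continuousOrderHom {x y : X} (h : ∀ f : X →Co I, f x ≤ f y) : x ≤ y := by
  by_contra hxy
  obtain ⟨f, hm, h0, h1⟩ := isClosedPreorder_le.exists_urysohn_unitInterval
    (isClosed_singleton (x := y)) (isClosed_singleton (x := x)) (by
      rintro a rfl b rfl
      exact hxy)
  have := h (f.toContinuousOrderHom hm)
  change f x ≤ f y at this
  rw [h0 y rfl, h1 x rfl] at this
  exact absurd this (by simp)

/-- A point outside a closed set is detected by a pair of morphisms that agree on the set. -/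
theorem exists_continuousOrderHom_ne {Y : Set X} (hY : IsClosed Y) {p : X} (hp : p ∉ Y) :
    ∃ g h : X →Co I, (∀ y ∈ Y, g y = h y) ∧ g p ≠ h p := by
  -- Being 0 on the points of `Y` below `p` and 1 on those above, `f` leaves both 0 and 1 admissible
  -- as values at `p`.
  obtain ⟨f, hm, h0, h1⟩ := isClosedPreorder_le.exists_urysohn_unitInterval
    (hY.inter (isClosed_Iic (a := p))) (hY.inter (isClosed_Ici (a := p))) (by
      rintro x ⟨hxY, hx⟩ y ⟨hyY, hy⟩ hxy
      have : x = p := le_antisymm (hxy.trans hy) hx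
      exact hp (this ▸ hxY))
  obtain ⟨g, hgm, hg, hgp⟩ := isClosedPreorder_le.exists_extension_insert hY
    f.continuous.continuousOn (fun x _ y _ => hm x y) hp 0
    (fun x hx hxp => (h0 x ⟨hx, hxp⟩).le) (fun x _ _ => bot_le)
  obtain ⟨h, hhm, hh, hhp⟩ := isClosedPreorder_le.exists_extension_insert hY
    f.continuous.continuousOn (fun x _ y _ => hm x y) hp 1
    (fun x _ _ => le_top) (fun x hx hxp => (h1 x ⟨hx, hxp⟩).ge)
  refine ⟨g.toContinuousOrderHom hgm, h.toContinuousOrderHom hhm,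
    fun y hy => (hg y hy).trans (hh y hy).symm, ?_⟩
  change g p ≠ h p
  rw [hgp, hhp]
  simp

/-- Every nonempty closed subset of a compact ordered space has a maximal element. -/
theorem IsClosed.exists_maximal_of_compactSpace {s : Set X} (hs : IsClosed s) (hne : s.Nonempty) :
    ∃ m, Maximal (· ∈ s) m := by
  obtain ⟨a, ha⟩ := hne
  obtain ⟨m, -, hm⟩ := zorn_le_nonempty₀ s (fun c hcs hc y hy => by
    have hcompact : (⋂ x : c, Ici (x : X) ∩ s).Nonempty := by
      have : Nonempty c := ⟨⟨y, hy⟩⟩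
      refine IsCompact.nonempty_iInter_of_directed_nonempty_isCompact_isClosed _ ?_ ?_ ?_ ?_
      · rintro ⟨x, hx⟩ ⟨z, hz⟩
        rcases hc.total hx hz with h | h
        · exact ⟨⟨z, hz⟩, inter_subset_inter_left _ (Ici_subset_Ici.2 h), subset_rfl⟩
        · exact ⟨⟨x, hx⟩, subset_rfl, inter_subset_inter_left _ (Ici_subset_Ici.2 h)⟩
      · exact fun x => ⟨x, le_refl (x : X), hcs x.2⟩
      · exact fun x => (isClosed_Ici.inter hs).isCompact
      · exact fun x => isClosed_Ici.inter hs
    obtain ⟨u, hu⟩ := hcompact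
    rw [mem_iInter] at hu
    exact ⟨u, (hu ⟨y, hy⟩).2, fun z hz => (hu ⟨z, hz⟩).1⟩) a ha
  exact ⟨m, hm⟩

/-- A continuous function on a compact space that is monotone for the preorder of a family of
functions is a continuous monotone function of that family. -/
theorem exists_continuousOrderHom_comp {W ι : Type*} [TopologicalSpace W] [CompactSpace W]
    (e : ι → C(W, I)) (h : C(W, I)) (hmono : ∀ a b, (∀ i, e i a ≤ e i b) → h a ≤ h b) :
    ∃ g : (ι → I) →Co I, ∀ w, g (fun i => e i w) = h w := by
  let E : W → ι → I := fun w i => e i w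
  have hE : Continuous E := by fun_prop
  have hEc : IsClosedMap E := hE.isClosedMap
  have heq : ∀ a b, E a = E b → h a = h b := fun a b hab =>
    le_antisymm (hmono a b fun i => (congrFun hab i).le) (hmono b a fun i => (congrFun hab i).ge)
  -- By `heq`, `h` factors through `E`; the default 0 off the range plays no role.
  let f : (ι → I) → I := Function.extend E h fun _ => 0
  have hf : ∀ w, f (E w) = h w := fun w => by
    by_cases hw : ∃ a, E a = E w
    · simp only [f, Function.extend, hw, dif_pos]
      exact heq _ _ (Classical.choose_spec hw)
    · exact absurd ⟨w, rfl⟩ hw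
  -- `E` is a closed map, hence a quotient map onto its range.
  have hfc : ContinuousOn f (range E) := by
    rw [continuousOn_iff_isClosed]
    intro t ht
    refine ⟨E '' (h ⁻¹' t), hEc _ (ht.preimage h.continuous), ?_⟩
    ext x
    constructor
    · rintro ⟨hx, w, rfl⟩
      exact ⟨⟨w, by rw [mem_preimage, ← hf]; exact hx, rfl⟩, ⟨w, rfl⟩⟩
    · rintro ⟨⟨w, hw, rfl⟩, -⟩
      exact ⟨by rw [mem_preimage, hf]; exact hw, ⟨w, rfl⟩⟩
  obtain ⟨g, hgm, hg⟩ := isClosedPreorder_le.exists_extension hEc.isClosed_range hfc (by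
    rintro _ ⟨a, rfl⟩ _ ⟨b, rfl⟩ hab
    rw [hf, hf]
    exact hmono a b hab)
  exact ⟨g.toContinuousOrderHom hgm, fun w => (hg _ ⟨w, rfl⟩).trans (hf w)⟩

end CompactOrdered

/-- A continuous function on a power of the unit interval depends on countably many coordinates. -/
theorem exists_countable_dependsOn {ι : Type*} {f : (ι → I) → I} (hf : Continuous f) :
    ∃ N : Set ι, N.Countable ∧ ∀ x y : ι → I, (∀ i ∈ N, x i = y i) → f x = f y := by
  have huc : UniformContinuous f := CompactSpace.uniformContinuous_of_continuous hf
  have hfin : ∀ n : ℕ, ∃ F : Set ι, F.Finite ∧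
      ∀ x y : ι → I, (∀ i ∈ F, x i = y i) → dist (f x) (f y) < 1 / ((n : ℝ) + 1) := by
    intro n
    have h := huc (Metric.dist_mem_uniformity (Nat.one_div_pos_of_nat (n := n) (α := ℝ)))
    rw [Filter.mem_map, Pi.uniformity, Filter.mem_iInf] at h
    obtain ⟨F, hF, V, hV, hUV⟩ := h
    refine ⟨F, hF, fun x y hxy => ?_⟩
    have : (x, y) ∈ ⋂ i : F, V i := by
      rw [mem_iInter]
      intro i
      obtain ⟨W, hW, hWV⟩ := hV i
      refine hWV ?_
      change (x i, y i) ∈ W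
      rw [hxy i i.2]
      exact refl_mem_uniformity hW
    rw [← hUV] at this
    exact this
  choose F hF hFd using hfin
  refine ⟨⋃ n, F n, countable_iUnion fun n => (hF n).countable, fun x y hxy => ?_⟩
  refine dist_le_zero.1 (le_of_forall_pos_lt_add fun ε hε => ?_)
  obtain ⟨n, hn⟩ := exists_nat_one_div_lt hε
  rw [zero_add]
  exact (hFd n x y fun i hi => hxy i (mem_iUnion.2 ⟨n, hi⟩)).trans hn

namespace Signature

variable {S : Signature.{v, u}}

/-! ### Generalities on algebras -/

/-- Homomorphisms commute with the evaluation of terms. -/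
theorem Term.map_eval {A B : S.Alg} (h : A ⟶ B) {X : Type u} (t : S.Term X) (a : X → A) :
    h.toFun (t.eval A a) = t.eval B fun x => h.toFun (a x) := by
  induction t with
  | var x => rfl
  | app f t ih =>
    refine (h.map_op f _).trans ?_
    exact congrArg (B.op f) (funext ih)

/-- A relation compatible with the operations is compatible with terms. -/
theorem Term.eval_congr_rel {A : S.Alg} {θ : A → A → Prop}
    (hop : ∀ f a b, (∀ i, θ (a i) (b i)) → θ (A.op f a) (A.op f b)) {X : Type u} (t : S.Term X)
    {a b : X → A} (hab : ∀ x, θ (a x) (b x)) : θ (t.eval A a) (t.eval A b) := by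
  induction t with
  | var x => exact hab x
  | app f t ih => exact hop f _ _ ih

/-- A bijective homomorphism is an isomorphism. -/
noncomputable def Alg.isoOfBijective {A B : S.Alg} (h : A ⟶ B) (hh : Function.Bijective h.toFun) :
    A ≅ B where
  hom := h
  inv :=
    { toFun := (Equiv.ofBijective h.toFun hh).symm
      map_op := fun f b => by
        rw [Equiv.symm_apply_eq]
        refine Eq.trans ?_ (h.map_op f _).symm
        exact congrArg (B.op f) (funext fun i =>
          ((Equiv.ofBijective h.toFun hh).apply_symm_apply (b i)).symm) }
  hom_inv_id := Alg.Hom.ext (funext fun a => (Equiv.ofBijective h.toFun hh).symm_apply_apply a)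
  inv_hom_id := Alg.Hom.ext (funext fun b => (Equiv.ofBijective h.toFun hh).apply_symm_apply b)

/-- `SP(A)` consists of the algebras whose points are separated by the homomorphisms to `A`. -/
theorem sp_iff {A B : S.Alg} :
    SP A B ↔ ∀ b b' : B, (∀ h : B ⟶ A, h.toFun b = h.toFun b') → b = b' := by
  constructor
  · rintro ⟨C, ⟨J, D, hD, ⟨i⟩⟩, h, hinj⟩ b b' hb
    obtain rfl : D = fun _ => A := funext hD
    let k : B ⟶ Alg.pi fun _ : J => A := h ≫ i.hom
    have hk : k.toFun b = k.toFun b' := by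
      funext j
      let π : (Alg.pi fun _ : J => A) ⟶ A := ⟨fun a => a j, fun _ _ => rfl⟩
      exact hb (k ≫ π)
    apply hinj
    have hi : ∀ c, i.inv.toFun (i.hom.toFun c) = c := fun c =>
      congrFun (congrArg Alg.Hom.toFun i.hom_inv_id) c
    rw [← hi (h.toFun b), ← hi (h.toFun b')]
    exact congrArg i.inv.toFun hk
  · intro hsep
    refine ⟨Alg.pi fun _ : (B ⟶ A) => A, ⟨_, _, fun _ => rfl, ⟨Iso.refl _⟩⟩,
      ⟨fun b h => h.toFun b, fun f b => funext fun h => h.map_op f b⟩, fun b b' hb => ?_⟩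
    exact hsep b b' fun h => congrFun hb h

/-- The algebras in `SP(A)` satisfy the equations of `A`. -/
theorem SP.satisfies {A B : S.Alg} (hB : SP A B) {e : S.Equation} (he : A.Satisfies e) :
    B.Satisfies e := by
  intro b
  refine sp_iff.1 hB _ _ fun h => ?_
  rw [Term.map_eval, Term.map_eval]
  exact he _

/-! ### Interpretations by continuous monotone functions -/

variable (int : ∀ f : S.Op, (S.arity f → I) →Co I)

/-- The unit interval as an algebra, for an interpretation of the operation symbols by continuous
monotone functions. -/
def intervalAlg : S.Alg where
  carrier := ULift.{u} I
  op f a := ULift.up (int f fun i => (a i).down)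

/-- The algebra of continuous monotone functions to the unit interval. -/
def funAlg (X : Type u) [TopologicalSpace X] [Preorder X] : S.Alg where
  carrier := X →Co I
  op f a := (int f).comp
    { toFun := fun x i => a i x
      monotone' := fun _ _ hxy i => (a i).monotone' hxy
      continuous_toFun := continuous_pi fun i => (a i).continuous_toFun }

/-- Evaluation at a point. -/
def evalHom {X : Type u} [TopologicalSpace X] [Preorder X] (x : X) :
    funAlg int X ⟶ intervalAlg int :=
  ⟨fun f => ULift.up (DFunLike.coe (F := X →Co I) f x), fun _ _ => rfl⟩

theorem sp_funAlg (X : Type u) [TopologicalSpace X] [Preorder X] :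
    SP (intervalAlg int) (funAlg int X) :=
  sp_iff.2 fun f g h => ContinuousOrderHom.ext (f := f) (g := g) fun x =>
    congrArg ULift.down (h (evalHom int x))

theorem Term.eval_funAlg {X : Type u} [TopologicalSpace X] [Preorder X] {J : Type u}
    (t : S.Term J) (a : J → X →Co I) (x : X) :
    t.eval (intervalAlg int) (fun j => ULift.up (a j x)) =
      ULift.up (DFunLike.coe (F := X →Co I) (t.eval (funAlg int X) a) x) :=
  (Term.map_eval (evalHom int x) t a).symm

/-- Every continuous monotone operation on the unit interval is a term operation. -/
def IsComplete : Prop :=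
  ∀ (X : Type u) (g : (X → I) →Co I), ∃ t : S.Term X,
    ∀ a : X → I, t.eval (intervalAlg int) (fun x => ULift.up (a x)) = ULift.up (g a)

/-! ### Free algebras as algebras of functions on cubes -/

namespace IsComplete

variable {int} (hcomp : IsComplete int)

/-- A term that represents a given continuous monotone operation. -/
noncomputable def term {X : Type u} (g : (X → I) →Co I) : S.Term X :=
  (hcomp X g).choose

theorem eval_term {X : Type u} (g : (X → I) →Co I) (a : X → ULift.{u} I) :
    (hcomp.term g).eval (intervalAlg int) a = ULift.up (g fun x => (a x).down) :=
  (hcomp X g).choose_spec fun x => (a x).down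

/-- The coordinate projections, as generators of the algebra of functions on a power. -/
def proj {X : Type u} (x : X) : (X → I) →Co I where
  toFun a := a x
  monotone' _ _ h := h x
  continuous_toFun := continuous_apply x

/-- Terms act pointwise and the projections return the coordinates of a point; hence the projections
generate. -/
theorem eval_term_proj {X : Type u} (g : (X → I) →Co I) :
    (hcomp.term g).eval (funAlg int (X → I)) proj = g :=
  ContinuousOrderHom.ext fun a => ULift.up_injective <|
    (Term.eval_funAlg int _ _ a).symm.trans (hcomp.eval_term g _)

/-- The homomorphism from an algebra of functions on a power determined by its values at the
projections. -/
noncomputable def lift {B : S.Alg}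
    (hB : ∀ e : S.Equation, (intervalAlg int).Satisfies e → B.Satisfies e) {X : Type u}
    (b : X → B) : funAlg int (X → I) ⟶ B where
  toFun g := (hcomp.term g).eval B b
  map_op f a := by
    let F := funAlg int (X → I)
    refine hB ⟨X, hcomp.term (F.op f a), .app f fun i => hcomp.term (a i)⟩ (fun c => ?_) b
    refine (hcomp.eval_term (F.op f a) c).trans ?_
    exact congrArg (fun z => ULift.up (int f z)) (funext fun i =>
      congrArg ULift.down (hcomp.eval_term (a i) c).symm)

/-- The term chosen for `proj x` need not be the variable `x`, but the two agree in the interval. -/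
theorem lift_proj {B : S.Alg}
    (hB : ∀ e : S.Equation, (intervalAlg int).Satisfies e → B.Satisfies e) {X : Type u}
    (b : X → B) (x : X) : (hcomp.lift hB b).toFun (proj x) = b x :=
  hB ⟨X, hcomp.term (proj x), .var x⟩ (fun c => hcomp.eval_term (proj x) c) b

include hcomp in
theorem hom_ext {B : S.Alg} {X : Type u} {h k : funAlg int (X → I) ⟶ B}
    (hk : ∀ x, h.toFun (proj x) = k.toFun (proj x)) : h = k := by
  refine Alg.Hom.ext (funext fun g => ?_)
  have hg : ∀ l : funAlg int (X → I) ⟶ B,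
      l.toFun g = (hcomp.term g).eval B fun x => l.toFun (proj x) := fun l =>
    (congrArg l.toFun (hcomp.eval_term_proj g)).symm.trans (Term.map_eval l _ _)
  exact (hg h).trans ((congrArg (fun b => (hcomp.term g).eval B b) (funext hk)).trans (hg k).symm)

include hcomp in
theorem hasFreeAlgebras : HasFreeAlgebras (SP (intervalAlg int)) := fun X =>
  ⟨funAlg int (X → I), proj, sp_funAlg int _, fun _ hB b =>
    ⟨hcomp.lift (fun _ he => hB.satisfies he) b, hcomp.lift_proj _ b, fun _ hk =>
      hcomp.hom_ext fun x => (hk x).trans (hcomp.lift_proj _ b x).symm⟩⟩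

/-! ### Congruences are determined by closed subspaces -/

section Congruence

/-- A pair of functions on `X`, as a function on the sum of two copies of `X`. -/
def copair {X : Type u} [TopologicalSpace X] [Preorder X] (p q : X →Co I) : C(X ⊕ X, I) where
  toFun := Sum.elim p q
  continuous_toFun := p.continuous_toFun.sumElim q.continuous_toFun

variable {X : Type u} [TopologicalSpace X] [PartialOrder X] [CompactSpace X]

include hcomp in
/-- A compatible relation contains all pairs of functions that are monotone for the preorder that it
determines on the sum of two copies of the space. -/
theorem rel_of_copair_mono {θ : (X →Co I) → (X →Co I) → Prop}
    (hop : ∀ f (a b : S.arity f → X →Co I), (∀ i, θ (a i) (b i)) →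
      θ ((funAlg int X).op f a) ((funAlg int X).op f b)) {p q : X →Co I}
    (hpq : ∀ a b : X ⊕ X, (∀ i : {i : (X →Co I) × (X →Co I) // θ i.1 i.2},
      copair i.1.1 i.1.2 a ≤ copair i.1.1 i.1.2 b) → copair p q a ≤ copair p q b) :
    θ p q := by
  -- The coordinates are the pairs in θ: one term sends their first components to `p` and their
  -- second components to `q`.
  obtain ⟨g, hg⟩ := exists_continuousOrderHom_comp
    (fun i : {i : (X →Co I) × (X →Co I) // θ i.1 i.2} => copair i.1.1 i.1.2) (copair p q) hpq
  have key := Term.eval_congr_rel (A := funAlg int X) (θ := θ) hop (hcomp.term g)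
    (a := fun i => i.1.1) (b := fun i => i.1.2) fun i => i.2
  have h1 : (hcomp.term g).eval (funAlg int X) (fun i => i.1.1) = p :=
    ContinuousOrderHom.ext fun x => ULift.up_injective <|
      (Term.eval_funAlg int _ _ x).symm.trans ((hcomp.eval_term g _).trans
        (congrArg ULift.up (hg (Sum.inl x))))
  have h2 : (hcomp.term g).eval (funAlg int X) (fun i => i.1.2) = q :=
    ContinuousOrderHom.ext fun x => ULift.up_injective <|
      (Term.eval_funAlg int _ _ x).symm.trans ((hcomp.eval_term g _).trans
        (congrArg ULift.up (hg (Sum.inr x))))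
  rw [h1, h2] at key
  exact key

variable [OrderClosedTopology X]

include hcomp in
/-- If all pairs in the congruence `θ` satisfy `p x ≤ q y`, there is an interpolating point. -/
theorem exists_interpolant {θ : (X →Co I) → (X →Co I) → Prop} (hθ : Equivalence θ)
    (hop : ∀ f (a b : S.arity f → X →Co I), (∀ i, θ (a i) (b i)) →
      θ ((funAlg int X).op f a) ((funAlg int X).op f b)) {x y : X}
    (hxy : ∀ p q, θ p q → p x ≤ q y) :
    ∃ w, (∀ p q, θ p q → p x ≤ q w) ∧ ∀ p q, θ p q → p w ≤ q y := by
  by_contra! hno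
  have hclosed : ∀ p q : X →Co I, ∀ z : X, IsClosed {w | p z ≤ q w} ∧ IsClosed {w | p w ≤ q z} :=
    fun p q z => ⟨isClosed_le continuous_const q.continuous_toFun,
      isClosed_le p.continuous_toFun continuous_const⟩
  have hC : IsClosed {w | ∀ p q, θ p q → p x ≤ q w} := by
    simp only [ofPred_forall]
    exact isClosed_iInter fun p => isClosed_iInter fun q => isClosed_iInter fun _ =>
      (hclosed p q x).1
  have hD : IsClosed {w | ∀ p q, θ p q → p w ≤ q y} := by
    simp only [ofPred_forall]
    exact isClosed_iInter fun p => isClosed_iInter fun q => isClosed_iInter fun _ =>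
      (hclosed p q y).2
  -- `g` is 1 on the points that θ puts above `x` and 0 on those it puts below `y`; the failure of
  -- interpolation allows this.
  obtain ⟨g, hgm, hg0, hg1⟩ := isClosedPreorder_le.exists_urysohn_unitInterval hD hC (by
    intro a ha b hb hab
    obtain ⟨p, q, hpq, hlt⟩ := hno a ha
    exact absurd ((p.monotone' hab).trans (hb p q hpq)) (not_le.2 hlt))
  let g' : X →Co I := g.toContinuousOrderHom hgm
  let e : {i : (X →Co I) × (X →Co I) // θ i.1 i.2} → C(X ⊕ X, I) := fun i => copair i.1.1 i.1.2
  have hr := isClosedPreorder_of_family e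
  have hinl : ∀ a b : X, (∀ i, e i (Sum.inl a) ≤ e i (Sum.inl b)) ↔ a ≤ b := fun a b =>
    ⟨fun h => le_of_forall_continuousOrderHom fun f => h ⟨(f, f), hθ.refl f⟩,
      fun h i => i.1.1.monotone' h⟩
  have hinr : ∀ a b : X, (∀ i, e i (Sum.inr a) ≤ e i (Sum.inr b)) ↔ a ≤ b := fun a b =>
    ⟨fun h => le_of_forall_continuousOrderHom fun f => h ⟨(f, f), hθ.refl f⟩,
      fun h i => i.1.2.monotone' h⟩
  -- `F` is a pair (f, g) with f(x) = 1 and `H` below is a pair (g, h) with h(y) = 0. Both lie in θ,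
  -- so transitivity contradicts `hxy`.
  obtain ⟨F, hFm, hFg, hFx⟩ := hr.exists_extension_insert (A := range Sum.inr)
    (f := Sum.elim g g) isClosed_range_inr (by fun_prop)
    (by
      rintro _ ⟨a, rfl⟩ _ ⟨b, rfl⟩ hab
      exact hgm a b ((hinr a b).1 hab))
    (p := Sum.inl x) (by simp) 1 (fun _ _ _ => le_top) (by
      rintro _ ⟨a, rfl⟩ ha
      exact (hg1 a fun p q hpq => ha ⟨(p, q), hpq⟩).ge)
  obtain ⟨H, hHm, hHg, hHy⟩ := hr.exists_extension_insert (A := range Sum.inl)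
    (f := Sum.elim g g) isClosed_range_inl (by fun_prop)
    (by
      rintro _ ⟨a, rfl⟩ _ ⟨b, rfl⟩ hab
      exact hgm a b ((hinl a b).1 hab))
    (p := Sum.inr y) (by simp) 0 (by
      rintro _ ⟨a, rfl⟩ ha
      exact (hg0 a fun p q hpq => ha ⟨(p, q), hpq⟩).le) (fun _ _ _ => bot_le)
  let f : X →Co I := ⟨⟨fun a => F (Sum.inl a), fun a b hab => hFm _ _ ((hinl a b).2 hab)⟩,
    F.continuous.comp continuous_inl⟩
  let h : X →Co I := ⟨⟨fun a => H (Sum.inr a), fun a b hab => hHm _ _ ((hinr a b).2 hab)⟩,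
    H.continuous.comp continuous_inr⟩
  have hF : ∀ a, copair f g' a = F a := by
    rintro (a | a)
    · rfl
    · exact (hFg _ ⟨a, rfl⟩).symm
  have hH : ∀ a, copair g' h a = H a := by
    rintro (a | a)
    · exact (hHg _ ⟨a, rfl⟩).symm
    · rfl
  have hfg : θ f g' := hcomp.rel_of_copair_mono hop fun a b hab => by
    rw [hF, hF]
    exact hFm a b hab
  have hgh : θ g' h := hcomp.rel_of_copair_mono hop fun a b hab => by
    rw [hH, hH]
    exact hHm a b hab
  have hle : F (Sum.inl x) ≤ H (Sum.inr y) := hxy f h (hθ.trans hfg hgh)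
  rw [hFx, hHy] at hle
  exact absurd hle (by simp)

include hcomp in
/-- Every congruence is the agreement of functions on a set of points. -/
theorem rel_of_eq_on_points {θ : (X →Co I) → (X →Co I) → Prop} (hθ : Equivalence θ)
    (hop : ∀ f (a b : S.arity f → X →Co I), (∀ i, θ (a i) (b i)) →
      θ ((funAlg int X).op f a) ((funAlg int X).op f b)) {f g : X →Co I}
    (hfg : ∀ x, (∀ p q, θ p q → p x = q x) → f x = g x) : θ f g := by
  have hbetween : ∀ x y : X, (∀ p q, θ p q → p x ≤ q y) →
      ∃ z, x ≤ z ∧ z ≤ y ∧ f z = g z := by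
    intro x y hxy
    have hcl : IsClosed {z | x ≤ z ∧ ∀ p q, θ p q → p z ≤ q y} := by
      refine isClosed_Ici.inter ?_
      change IsClosed {z | ∀ p q, θ p q → p z ≤ q y}
      simp only [ofPred_forall]
      exact isClosed_iInter fun p => isClosed_iInter fun q => isClosed_iInter fun _ =>
        isClosed_le p.continuous_toFun continuous_const
    -- Interpolating between a maximal `m` and `y` returns `m` itself, since diagonal pairs give m ≤
    -- w. By symmetry all pairs then agree at `m`.
    obtain ⟨m, ⟨hxm, hmy⟩, hmax⟩ := hcl.exists_maximal_of_compactSpace ⟨x, le_refl x, hxy⟩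
    obtain ⟨w, hmw, hwy⟩ := hcomp.exists_interpolant hθ hop hmy
    have hle : m ≤ w := le_of_forall_continuousOrderHom fun p => hmw p p (hθ.refl p)
    have hwm : w = m := le_antisymm (hmax ⟨hxm.trans hle, hwy⟩ hle) hle
    subst hwm
    exact ⟨w, hxm, le_of_forall_continuousOrderHom fun p => hmy p p (hθ.refl p),
      hfg w fun p q hpq => le_antisymm (hmw p q hpq) (hmw q p (hθ.symm hpq))⟩
  refine hcomp.rel_of_copair_mono hop ?_
  rintro (a | a) (b | b) hab
  · exact f.monotone' (le_of_forall_continuousOrderHom fun p => hab ⟨(p, p), hθ.refl p⟩)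
  · obtain ⟨z, haz, hzb, hz⟩ := hbetween a b fun p q hpq => hab ⟨(p, q), hpq⟩
    exact (f.monotone' haz).trans (hz.le.trans (g.monotone' hzb))
  · obtain ⟨z, haz, hzb, hz⟩ := hbetween a b fun p q hpq => hab ⟨(q, p), hθ.symm hpq⟩
    exact (g.monotone' haz).trans (hz.ge.trans (f.monotone' hzb))
  · exact g.monotone' (le_of_forall_continuousOrderHom fun p => hab ⟨(p, p), hθ.refl p⟩)

end Congruence

include hcomp in
theorem isEquational : IsEquational (SP (intervalAlg int)) := by
  refine ⟨{e | (intervalAlg int).Satisfies e}, fun B => ⟨fun hB e he => hB.satisfies he,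
    fun hB => sp_iff.2 fun b b' hbb => ?_⟩⟩
  let q := hcomp.lift hB (fun b : B => b)
  have hq : ∀ b, q.toFun (proj b) = b := hcomp.lift_proj hB _
  have key := hcomp.rel_of_eq_on_points (X := B → I) (θ := fun f g => q.toFun f = q.toFun g)
    ⟨fun _ => rfl, Eq.symm, Eq.trans⟩
    (fun f a c hac => (q.map_op f a).trans
      ((congrArg (B.op f) (funext hac)).trans (q.map_op f c).symm))
    (f := proj b) (g := proj b') fun x hx => by
      -- Agreement of the congruent pairs at `x` makes `x : B → I` itself a homomorphism.
      let h : B ⟶ intervalAlg int :=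
        ⟨fun c => ULift.up (x c), fun f c => by
          refine congrArg ULift.up (hx (proj (B.op f c)) ((funAlg int (B → I)).op f
            fun i => proj (c i)) ?_)
          refine (hq _).trans (Eq.trans ?_ (q.map_op f _).symm)
          exact congrArg (B.op f) (funext fun i => (hq (c i)).symm)⟩
      exact congrArg ULift.down (hbb h)
  simpa only [hq] using key

include hcomp in
theorem isVariety : IsVariety (SP (intervalAlg int)) :=
  ⟨hcomp.isEquational, hcomp.hasFreeAlgebras⟩

/-! ### The dual equivalence -/

include hcomp in
/-- Every homomorphism to the unit interval is the evaluation at a point. -/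
theorem exists_eq_evalHom {X : Type u} [TopologicalSpace X] [PartialOrder X] [CompactSpace X]
    [OrderClosedTopology X] (φ : funAlg int X ⟶ intervalAlg int) : ∃ x, φ = evalHom int x := by
  let E : X → (X →Co I) → I := fun x f => f x
  have hE : Continuous E := continuous_pi fun f => f.continuous_toFun
  by_cases hφ : (fun f => (φ.toFun f).down) ∈ range E
  · obtain ⟨x, hx⟩ := hφ
    exact ⟨x, Alg.Hom.ext (funext fun f => ULift.down_injective (congrFun hx f).symm)⟩
  -- The terms of `g` and `h` have equal values in the algebra of functions on `X`, so `φ` cannot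
  -- tell them apart.
  · obtain ⟨g, h, hgh, hne⟩ := exists_continuousOrderHom_ne hE.isClosedMap.isClosed_range hφ
    refine absurd ?_ hne
    have hval : ∀ k : ((X →Co I) → I) →Co I, k (fun f => (φ.toFun f).down) =
        (φ.toFun ((hcomp.term k).eval (funAlg int X) fun f => f)).down := fun k =>
      congrArg ULift.down ((Term.map_eval φ _ _).trans (hcomp.eval_term k _)).symm
    have heval : ∀ (k : ((X →Co I) → I) →Co I) (x : X),
        DFunLike.coe (F := X →Co I) ((hcomp.term k).eval (funAlg int X) fun f => f) x = k (E x) :=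
      fun k x => ULift.up_injective <|
        (Term.eval_funAlg int _ _ x).symm.trans (hcomp.eval_term k _)
    refine (hval g).trans (Eq.trans ?_ (hval h).symm)
    refine congrArg (fun z => (φ.toFun z).down) (ContinuousOrderHom.ext fun x => ?_)
    exact (heval g x).trans ((hgh _ ⟨x, rfl⟩).trans (heval h x).symm)

variable (int) in
/-- The contravariant functor of continuous monotone functions to the unit interval. -/
def dualFunctor : CompOrd.{u}ᵒᵖ ⥤ S.Alg where
  obj X := funAlg int X.unop
  map f := ⟨fun g => ContinuousOrderHom.comp g f.unop, fun _ _ => rfl⟩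

theorem faithful_dualFunctor : (dualFunctor int).Faithful where
  map_injective {X Y f g} hfg := by
    refine Quiver.Hom.unop_inj (ContinuousOrderHom.ext fun y => ?_)
    have h : ∀ k : X.unop →Co I, k (f.unop.toFun y) = k (g.unop.toFun y) := fun k =>
      DFunLike.congr_fun (F := Y.unop →Co I) (congrFun (congrArg Alg.Hom.toFun hfg) k) y
    exact le_antisymm (le_of_forall_continuousOrderHom fun k => (h k).le)
      (le_of_forall_continuousOrderHom fun k => (h k).ge)

include hcomp in
theorem full_dualFunctor : (dualFunctor int).Full where
  map_surjective {X Y} φ := by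
    -- `φ` followed by evaluation at `y` is evaluation at some point of `X`; these points define the
    -- required morphism.
    have hφ : ∀ y : Y.unop, ∃ x : X.unop, ∀ k : X.unop →Co I,
        DFunLike.coe (F := Y.unop →Co I) (φ.toFun k) y = k x := fun y => by
      obtain ⟨x, hx⟩ := hcomp.exists_eq_evalHom (X := X.unop) (φ ≫ evalHom int y)
      exact ⟨x, fun k => congrArg ULift.down (congrFun (congrArg Alg.Hom.toFun hx) k)⟩
    choose m hm using hφ
    have hmono : Monotone m := fun a b hab => le_of_forall_continuousOrderHom fun k => by
      rw [← hm, ← hm]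
      exact ContinuousOrderHomClass.map_monotone (F := Y.unop →Co I) _ hab
    have hind : IsInducing fun (x : X.unop) (k : X.unop →Co I) => k x := by
      refine (Continuous.isClosedEmbedding (continuous_pi fun k => k.continuous_toFun)
        fun x y hxy => ?_).isInducing
      exact le_antisymm (le_of_forall_continuousOrderHom fun k => (congrFun hxy k).le)
        (le_of_forall_continuousOrderHom fun k => (congrFun hxy k).ge)
    have hcont : Continuous m := by
      rw [hind.continuous_iff]
      refine continuous_pi fun k => ?_
      simp only [Function.comp_apply, ← hm]
      exact ContinuousOrderHom.continuous_toFun _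
    let M : Y.unop ⟶ X.unop := ⟨⟨m, hmono⟩, hcont⟩
    exact ⟨M.op, Alg.Hom.ext (funext fun k => ContinuousOrderHom.ext fun y => (hm y k).symm)⟩

variable (int) in
/-- The maps to the unit interval that are homomorphisms, as a set of points of a power. -/
def points (B : S.Alg) : Set (B → I) :=
  {φ | ∀ f b, φ (B.op f b) = int f fun i => φ (b i)}

theorem isClosed_points (B : S.Alg) : IsClosed (points int B) := by
  simp only [points, ofPred_forall]
  exact isClosed_iInter fun f => isClosed_iInter fun b => isClosed_eq (continuous_apply _)
    ((int f).continuous_toFun.comp (continuous_pi fun i => continuous_apply _))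

variable (int) in
/-- The compact ordered space of homomorphisms to the unit interval. -/
def spectrum (B : S.Alg) : CompOrd.{u} :=
  have : CompactSpace (points int B) := isCompact_iff_compactSpace.1 (isClosed_points B).isCompact
  ⟨points int B⟩

variable (int) in
/-- Elements of an algebra as functions on its space of homomorphisms to the unit interval. -/
def toFunAlg (B : S.Alg) : B ⟶ funAlg int (spectrum int B) :=
  ⟨fun b => ⟨⟨fun φ => φ.1 b, fun _ _ h => h b⟩, (continuous_apply b).comp continuous_subtype_val⟩,
    fun f b => ContinuousOrderHom.ext fun φ => φ.2 f b⟩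

-- Injectivity is `sp_iff`. For surjectivity, a function on the spectrum extends to the cube on `B`,
-- and the extension is a term.
include hcomp in
theorem bijective_toFunAlg {B : S.Alg} (hB : SP (intervalAlg int) B) :
    Function.Bijective (toFunAlg int B).toFun := by
  constructor
  · intro b b' hbb
    refine sp_iff.1 hB b b' fun h => ULift.down_injective ?_
    exact DFunLike.congr_fun (F := spectrum int B →Co I) hbb
      ⟨fun c => (h.toFun c).down, fun f c => congrArg ULift.down (h.map_op f c)⟩
  · intro k
    obtain ⟨g, hg⟩ := exists_continuousOrderHom_comp (W := spectrum int B)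
      (fun b : B => ContinuousOrderHom.toContinuousMap ((toFunAlg int B).toFun b))
      (ContinuousOrderHom.toContinuousMap k) fun φ ψ h => 
        ContinuousOrderHomClass.map_monotone (F := spectrum int B →Co I) k h
    refine ⟨(hcomp.term g).eval B fun b => b, ?_⟩
    rw [Term.map_eval]
    exact ContinuousOrderHom.ext fun φ => ULift.up_injective <|
      (Term.eval_funAlg int _ _ φ).symm.trans
        ((hcomp.eval_term g _).trans (congrArg ULift.up (hg φ)))

include hcomp in
/-- Compact ordered spaces are dual to the algebras in the class generated by the interval. -/
theorem nonempty_equivalence :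
    Nonempty (CompOrd.{u}ᵒᵖ ≌ (SP (intervalAlg int)).FullSubcategory) := by
  have hfaithful := faithful_dualFunctor (int := int)
  have hfull := hcomp.full_dualFunctor
  let G := (SP (intervalAlg int)).lift (dualFunctor int) fun X => sp_funAlg int X.unop
  have : G.Faithful := ⟨fun h => hfaithful.map_injective (congrArg (·.hom) h)⟩
  have : G.Full := ⟨fun φ => by
    obtain ⟨f, hf⟩ := hfull.map_surjective φ.hom
    exact ⟨f, ObjectProperty.hom_ext _ hf⟩⟩
  have : G.EssSurj := ⟨fun B => ⟨Opposite.op (spectrum int B.obj),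
    ⟨(SP (intervalAlg int)).isoMk
      (Alg.isoOfBijective (toFunAlg int B.obj) (hcomp.bijective_toFunAlg B.property)).symm⟩⟩⟩
  have : G.IsEquivalence := { }
  exact ⟨G.asEquivalence⟩

end IsComplete

/-! ### The concrete signatures -/

/-- Reindexing of variables along a map. -/
theorem exists_continuousOrderHom_reindex {X J : Type*} (g : (X → I) →Co I) (s : X → J) :
    ∃ k : (J → I) →Co I, ∀ a, k a = g fun x => a (s x) :=
  ⟨⟨⟨fun a => g fun x => a (s x), fun _ _ h => g.monotone' fun x => h (s x)⟩,
    g.continuous_toFun.comp (continuous_pi fun x => continuous_apply (s x))⟩, fun _ => rfl⟩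

/-- Arities are the chosen sets `κ.out`, so variables are renamed along a bijection with `X`. -/
theorem isComplete_OC : IsComplete (S := OC.{u}) fun f => f.2 := by
  intro X g
  obtain ⟨e⟩ : Nonempty ((Cardinal.mk X).out ≃ X) := Cardinal.eq.1 (Cardinal.mk_out _)
  obtain ⟨k, hk⟩ := exists_continuousOrderHom_reindex g e.symm
  refine ⟨.app ⟨Cardinal.mk X, k⟩ fun i => .var (e i), fun a => congrArg ULift.up ?_⟩
  refine (hk _).trans (congrArg g (funext fun x => ?_))
  exact congrArg a (e.apply_symm_apply x)

theorem isComplete_OCω : IsComplete (S := OCω.{u}) fun f => f.1.2 := by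
  intro X g
  obtain ⟨N, hN, hdep⟩ := exists_countable_dependsOn g.continuous_toFun
  obtain ⟨e⟩ : Nonempty ((Cardinal.mk N).out ≃ N) := Cardinal.eq.1 (Cardinal.mk_out _)
  classical
  -- Coordinates outside `N` are set to 0, which `hdep` makes harmless.
  let k : ((Cardinal.mk N).out → I) →Co I :=
    ⟨⟨fun a => g fun x => if h : x ∈ N then a (e.symm ⟨x, h⟩) else 0, fun a b hab =>
      g.monotone' fun x => by
        by_cases h : x ∈ N
        · simpa only [h, dif_pos] using hab _
        · simp only [h, dif_neg, not_false_iff, le_refl]⟩,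
      g.continuous_toFun.comp (continuous_pi fun x => by
        by_cases h : x ∈ N
        · simpa only [h, dif_pos] using continuous_apply _
        · simpa only [h, dif_neg, not_false_iff] using continuous_const)⟩
  refine ⟨.app ⟨⟨Cardinal.mk N, k⟩, Cardinal.mk_le_aleph0_iff.2 hN.to_subtype⟩
    fun i => .var (e i), fun a => congrArg ULift.up ?_⟩
  refine hdep _ _ fun x hx => ?_
  simp only [hx, dif_pos]
  exact congrArg a (congrArg Subtype.val (e.apply_symm_apply ⟨x, hx⟩))

theorem countable_arity_OCω (f : OCω.{u}.Op) : Countable (OCω.{u}.arity f) := by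
  rw [← Cardinal.mk_le_aleph0_iff]
  exact (Cardinal.mk_out f.1.1).trans_le f.2

end Signature

theorem mainTheorem1 :
    -- `CompOrd` is dually equivalent to a variety with operations of at most countable arity
    (∃ (S : Signature.{u + 1, u}) (K : ObjectProperty S.Alg),
      (∀ f : S.Op, Countable (S.arity f)) ∧ Signature.IsVariety K ∧
        Nonempty (CompOrd.{u}ᵒᵖ ≌ K.FullSubcategory)) ∧
    -- the concrete description with all order-preserving continuous operations
    (Signature.IsVariety (Signature.SP Signature.intervalOC.{u}) ∧
      Nonempty (CompOrd.{u}ᵒᵖ ≌ (Signature.SP Signature.intervalOC.{u}).FullSubcategory)) ∧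
    -- the concrete description with those of at most countable arity
    ((∀ f : Signature.OCω.{u}.Op, Countable (Signature.OCω.{u}.arity f)) ∧
      Signature.IsVariety (Signature.SP Signature.intervalOCω.{u}) ∧
      Nonempty (CompOrd.{u}ᵒᵖ ≌ (Signature.SP Signature.intervalOCω.{u}).FullSubcategory)) :=
  ⟨⟨Signature.OCω, _, Signature.countable_arity_OCω, Signature.isComplete_OCω.isVariety,
      Signature.isComplete_OCω.nonempty_equivalence⟩,
    ⟨Signature.isComplete_OC.isVariety, Signature.isComplete_OC.nonempty_equivalence⟩,
    Signature.countable_arity_OCω, Signature.isComplete_OCω.isVariety,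
    Signature.isComplete_OCω.nonempty_equivalence⟩
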